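/- **Theorem 3.4.** Let $a\in\mathbb R$, $a<b\le\infty$, and for $j=0,1$ consider $$\tau_j=\frac1{r_j}\Big(-\frac{\mathrm d}{\mathrm dx}p_j\frac{\mathrm d}{\mathrm dx}+q_j\Big)\quad\text{on }(a,b),$$ where $p_j,q_j,r_j$ are real-valued, $p_j>0$ and $r_j>0$ a.e., and $1/p_j,q_j,r_j\in L^1(a,c)$ for every $c\in(a,b)$ (that is, they are locally integrable on $(a,b)$ and $\tau_j$ is regular at $a$). A solution $u$ of $(\tau_j-\lambda)u=0$ is a function such that $u$ and $p_ju'$ are locally absolutely continuous and the equation holds a.e. Call $\tau_j-\lambda$ *nonoscillatory* if $(\tau_j-\lambda)u=0$ has a nontrivial real-valued solution with at most finitely many zeros in $(a,b)$, and *oscillatory* otherwise. Let $T_0$ be a self-adjoint realization of $\tau_0$ in $L^2((a,b);r_0)$ (a self-adjoint restriction of the maximal operator), and assume that its spectrum has a minimum $\lambda$. Suppose that $(\tau_0-\lambda)u=0$ has a minimal positive solution $u_0$ near $b$: for some $d\in[a,b)$, $u_0$ is a solution on $(d,b)$, $u_0>0$ on $(d,b)$, and $$\int_c^b\frac{\mathrm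 dt}{p_0(t)u_0(t)^2}=\infty\qquad\text{for } c\in(d,b).$$ Fix $c\in(d,b)$ and let $$v_0(x)=u_0(x)\int_c^x\frac{\mathrm dt}{p_0(t)u_0(t)^2},\qquad x\in(d,b).$$ Set $$\Delta=p_0v_0^2\Big(u_0^2\big(q_1-q_0-\lambda(r_1-r_0)\big)+(p_0u_0')^2\,\frac{p_1-p_0}{p_1p_0}\Big),$$ and suppose that $$\lim_{x\to b}v_0(x)\,p_0(x)u_0'(x)\,\frac{p_1(x)-p_0(x)}{p_1(x)}=\lim_{x\to b}\frac{p_1(x)-p_0(x)}{p_1(x)}=0.$$ Then $\tau_1-\lambda$ is oscillatory if $\limsup_{x\to b}\Delta(x)<-\tfrac14$, and nonoscillatory if $\liminf_{x\to b}\Delta(x)>-\tfrac14$. Here all limits, upper and lower limits as $x\to b$ are understood up to Lebesgue null sets (the coefficients being determined only a.e.), and the upper and lower limits take values in $[-\infty,\infty]$. -/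

import Mathlib

open Set Filter Topology MeasureTheory

noncomputable section

/-- The open interval `(a, b)` of real numbers with finite left endpoint `a`
and right endpoint `b ≤ ∞`. -/
def ivl (a : ℝ) (b : EReal) : Set ℝ := {x : ℝ | a < x ∧ (x : EReal) < b}

/-- The filter `x → b` from the left, where a Lebesgue null set may be disregarded.  The
coefficients of a Sturm--Liouville expression are only determined up to null sets, so limits,
upper limits and lower limits of functions built from them are taken along this filter. -/
def nearEnd (b : EReal) : Filter ℝ := comap Real.toEReal (𝓝[<] b) ⊓ ae volume

/-- The coefficients of `τ = r⁻¹ (- d/dx p d/dx + q)`. -/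
structure SLExpr where
  p : ℝ → ℝ
  q : ℝ → ℝ
  r : ℝ → ℝ

/-- Local absolute continuity on a set (used for intervals). -/
def LocAC {E : Type*} [PseudoMetricSpace E] (s : Set ℝ) (f : ℝ → E) : Prop :=
  ∀ x ∈ s, ∀ y ∈ s, AbsolutelyContinuousOnInterval f x y

namespace SLExpr

/-- The standing assumptions on the coefficients on `(a, b)`: `p, r > 0` a.e., and
`1/p`, `q`, `r` are integrable on `(a, c)` for every `c ∈ (a, b)`, that is, they are locally
integrable on `(a, b)` and `τ` is regular at the finite endpoint `a`. -/
structure Admissible (τ : SLExpr) (a : ℝ) (b : EReal) : Prop where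
  p_pos : ∀ᵐ x ∂volume.restrict (ivl a b), 0 < τ.p x
  r_pos : ∀ᵐ x ∂volume.restrict (ivl a b), 0 < τ.r x
  p_inv_int : ∀ c ∈ ivl a b, IntegrableOn (fun x => 1 / τ.p x) (Ioo a c)
  q_int : ∀ c ∈ ivl a b, IntegrableOn τ.q (Ioo a c)
  r_int : ∀ c ∈ ivl a b, IntegrableOn τ.r (Ioo a c)

/-- `τ u = g` on `(a, b)`: `u` is locally absolutely continuous, `p u'` agrees a.e. with a locally
absolutely continuous function `w`, and `r⁻¹ (- w' + q u) = g` a.e. on `(a, b)`. -/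
def MapsTo {𝕜 : Type*} [RCLike 𝕜] (τ : SLExpr) (a : ℝ) (b : EReal) (u g : ℝ → 𝕜) : Prop :=
  LocAC (ivl a b) u ∧ ∃ w : ℝ → 𝕜, LocAC (ivl a b) w ∧
    (∀ᵐ x ∂volume.restrict (ivl a b), w x = (τ.p x : 𝕜) * deriv u x) ∧
    ∀ᵐ x ∂volume.restrict (ivl a b),
      ((1 / τ.r x : ℝ) : 𝕜) * (- deriv w x + (τ.q x : 𝕜) * u x) = g x

/-- `u` is a real-valued solution of `(τ - lam) u = 0` on `(a, b)`. -/
def IsSolution (τ : SLExpr) (lam : ℝ) (a : ℝ) (b : EReal) (u : ℝ → ℝ) : Prop :=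
  τ.MapsTo a b u (fun x => lam * u x)

/-- `τ - lam` is nonoscillatory on `(a, b)`: some nontrivial real-valued solution has at most
finitely many zeros in `(a, b)`. -/
def Nonoscillatory (τ : SLExpr) (lam : ℝ) (a : ℝ) (b : EReal) : Prop :=
  ∃ u : ℝ → ℝ, τ.IsSolution lam a b u ∧ (∃ x ∈ ivl a b, u x ≠ 0) ∧
    {x ∈ ivl a b | u x = 0}.Finite

/-- `τ - lam` is oscillatory on `(a, b)`: it is not nonoscillatory. -/
def Oscillatory (τ : SLExpr) (lam : ℝ) (a : ℝ) (b : EReal) : Prop :=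
  ¬ τ.Nonoscillatory lam a b

/-- The measure `r(x) dx` on `(a, b)`. -/
def weight (τ : SLExpr) (a : ℝ) (b : EReal) : Measure ℝ :=
  (volume.restrict (ivl a b)).withDensity (fun x => ENNReal.ofReal (τ.r x))

/-- The complex Hilbert space `L²((a, b); r)`. -/
abbrev L2 (τ : SLExpr) (a : ℝ) (b : EReal) : Type := Lp ℂ 2 (τ.weight a b)

/-- `T` is a self-adjoint realization of `τ` in `L²((a, b); r)`: a self-adjoint operator (in
particular densely defined) that is a restriction of the maximal operator associated with `τ`,
i.e. every `f` in the domain of `T` has a representative `u` for which `τ u` is defined and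
`T f = τ u`. -/
def IsSelfAdjointRealization (τ : SLExpr) (a : ℝ) (b : EReal)
    (T : τ.L2 a b →ₗ.[ℂ] τ.L2 a b) : Prop :=
  IsSelfAdjoint T ∧ ∀ f : T.domain, ∃ u : ℝ → ℂ,
    (((f : τ.L2 a b) : ℝ → ℂ) =ᵐ[τ.weight a b] u) ∧ τ.MapsTo a b u (T f : ℝ → ℂ)

end SLExpr

/-- `z` is in the resolvent set of the (unbounded) operator `T`: `T - z` is a bijection of the
domain of `T` onto the space, with bounded everywhere defined inverse `R`. -/
def InResolventSet {H : Type*} [NormedAddCommGroup H] [NormedSpace ℂ H]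
    (T : H →ₗ.[ℂ] H) (z : ℂ) : Prop :=
  ∃ R : H →L[ℂ] H, (∀ f : T.domain, R (T f - z • (f : H)) = f) ∧
    ∀ g : H, ∃ h : R g ∈ T.domain, T ⟨R g, h⟩ - z • R g = g

/-- The spectrum of an (unbounded) operator. -/
def opSpectrum {H : Type*} [NormedAddCommGroup H] [NormedSpace ℂ H]
    (T : H →ₗ.[ℂ] H) : Set ℂ := {z | ¬ InResolventSet T z}

/-- `u` is a minimal (principal) positive solution of `(τ - lam) u = 0` near `b`: a positive
solution on `(d, b)` with `∫_c^b dt / (p u²) = ∞` for `c ∈ (d, b)`. -/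
def IsMinimalPositive (τ : SLExpr) (lam d : ℝ) (b : EReal) (u : ℝ → ℝ) : Prop :=
  τ.IsSolution lam d b u ∧ (∀ x ∈ ivl d b, 0 < u x) ∧
    ∀ c ∈ ivl d b, ∫⁻ t in ivl c b, ENNReal.ofReal (1 / (τ.p t * u t ^ 2)) = ⊤

/-- The second solution given by d'Alembert's formula with base point `c`. -/
def dAlembert (τ : SLExpr) (c : ℝ) (u : ℝ → ℝ) (x : ℝ) : ℝ :=
  u x * ∫ t in c..x, 1 / (τ.p t * u t ^ 2)

/-- The function `Δ`, built from the two expressions, `lam`, and the solutions `u`, `v`. -/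
def critDelta (τ₀ τ₁ : SLExpr) (lam : ℝ) (u v : ℝ → ℝ) (x : ℝ) : ℝ :=
  τ₀.p x * v x ^ 2 *
    (u x ^ 2 * (τ₁.q x - τ₀.q x - lam * (τ₁.r x - τ₀.r x)) +
      (τ₀.p x * deriv u x) ^ 2 * ((τ₁.p x - τ₀.p x) / (τ₁.p x * τ₀.p x)))

end

/-!
Write `u = u₀`, `w = p₀ u₀'` and `φ = v₀ / u₀ = ∫_c^x dt / (p₀ u₀²)`. Minimality of `u₀` says
that `φ → ∞` at `b`. Given a solution `y` of `(τ₁ - λ) y = 0` with quasi-derivative `z = p₁ y'`,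
pass to `g = y / u` and `h = φ (u z - w y)`, that is `φ` times the modified Wronskian of `u` and `y`. A
computation (`renormalizedSystem_of_solutions`) gives, with `s = φ' / φ`,
`g' = s (-ε₁ g + (1 - ε₂) h)` and `h' = s (Δ g + ε₁ h + h)`, where
`ε₁ = v₀ p₀ u₀' (p₁ - p₀) / p₁` and `ε₂ = (p₁ - p₀) / p₁` are the two quantities assumed to tend to
zero. In the variable `log φ`, which runs to `∞`, this is a small perturbation of the Euler system
`g' = h`, `h' = Δ g + h`, whose characteristic equation `μ² - μ - Δ = 0` changes character at
`Δ = -1/4`.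

* If `Δ ≤ -1/4 - η` near `b` and `y` has no zero near `b`, then `R = h / g` satisfies
  `R' ≤ -κ s (1 + R²)`. So `arctan R + κ log φ` is nonincreasing, which bounds `φ`, a contradiction
  (`RenormalizedSystem.bddAbove_of_ne_zero`). Hence every solution has infinitely many zeros.
* If `Δ ≥ -1/4 + η` near `b`, the system for `g` and `h - g / 2` has nonnegative coefficients, so
  the open positive quadrant is invariant (`RenormalizedSystem.pos`). The solution `y` starting in
  this quadrant at a point `x₀` near `b` is positive on `[x₀, b)`. Because `τ₁` is regular at `a`,
  this solution extends to `[a, b)` (`exists_solution_linear_system`, a contraction argument in a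
  weighted supremum norm), and it has finitely many zeros in `[a, x₀]`
  (`finite_zeros_of_linear_system`).

The coefficients are merely locally integrable, so all differential inequalities are used in the
form "a locally absolutely continuous function with nonnegative derivative a.e. is nondecreasing"; the
structure `LocACDeriv` carries the corresponding calculus.
-/

/-! ### Intervals with a possibly infinite right endpoint -/

/-- The half-open interval `[a, b)` with finite left endpoint and right endpoint `b ≤ ∞`. -/
def ivlCO (a : ℝ) (b : EReal) : Set ℝ := {x : ℝ | a ≤ x ∧ (x : EReal) < b}

lemma ordConnected_ivl (a : ℝ) (b : EReal) : (ivl a b).OrdConnected :=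
  ⟨fun _ hx _ hy _ hz => ⟨hx.1.trans_le hz.1, (EReal.coe_le_coe_iff.2 hz.2).trans_lt hy.2⟩⟩

lemma ordConnected_ivlCO (a : ℝ) (b : EReal) : (ivlCO a b).OrdConnected :=
  ⟨fun _ hx _ hy _ hz => ⟨hx.1.trans hz.1, (EReal.coe_le_coe_iff.2 hz.2).trans_lt hy.2⟩⟩

lemma measurableSet_ivl (a : ℝ) (b : EReal) : MeasurableSet (ivl a b) :=
  (ordConnected_ivl a b).measurableSet

lemma measurableSet_ivlCO (a : ℝ) (b : EReal) : MeasurableSet (ivlCO a b) :=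
  (ordConnected_ivlCO a b).measurableSet

lemma ivl_subset_ivlCO {a a' : ℝ} {b : EReal} (h : a ≤ a') : ivl a' b ⊆ ivlCO a b :=
  fun _ hx => ⟨h.trans hx.1.le, hx.2⟩

lemma ivlCO_subset_ivl {a x₀ : ℝ} {b : EReal} (h : a < x₀) : ivlCO x₀ b ⊆ ivl a b :=
  fun _ hx => ⟨h.trans_le hx.1, hx.2⟩

lemma exists_gt_lt_end {x : ℝ} {b : EReal} (h : (x : EReal) < b) :
    ∃ y : ℝ, x < y ∧ (y : EReal) < b := by
  obtain ⟨y, h₁, h₂⟩ := EReal.lt_iff_exists_real_btwn.1 h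
  exact ⟨y, EReal.coe_lt_coe_iff.1 h₁, h₂⟩

/-! ### Locally absolutely continuous functions with a prescribed derivative -/

/-- `f` is locally absolutely continuous on `I` and has derivative `f'` almost everywhere
on `I`. -/
structure LocACDeriv (I : Set ℝ) (f f' : ℝ → ℝ) : Prop where
  locAC : LocAC I f
  ae_hasDerivAt : ∀ᵐ x ∂volume.restrict I, HasDerivAt f (f' x) x

lemma LocAC.mono {f : ℝ → ℝ} {I J : Set ℝ} (h : LocAC I f) (hJ : J ⊆ I) : LocAC J f :=
  fun x hx y hy => h x (hJ hx) y (hJ hy)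

lemma LocAC.continuousOn {f : ℝ → ℝ} {I : Set ℝ} (h : LocAC I f) : ContinuousOn f I := by
  intro x hx
  have key : ∀ y ∈ I, ContinuousWithinAt f (uIcc x y) x := fun y hy =>
    (h x hx y hy).continuousOn x left_mem_uIcc
  have hr : ContinuousWithinAt f (I ∩ Ici x) x := by
    by_cases hex : ∃ y ∈ I, x < y
    · obtain ⟨y, hy, hxy⟩ := hex
      have := key y hy
      rw [uIcc_of_le hxy.le] at this
      exact ((continuousWithinAt_Icc_iff_Ici hxy).1 this).mono inter_subset_right
    · push Not at hex
      exact continuousWithinAt_singleton.mono fun y hy => le_antisymm (hex y hy.1) hy.2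
  have hl : ContinuousWithinAt f (I ∩ Iic x) x := by
    by_cases hex : ∃ y ∈ I, y < x
    · obtain ⟨y, hy, hxy⟩ := hex
      have := key y hy
      rw [uIcc_of_ge hxy.le] at this
      exact ((continuousWithinAt_Icc_iff_Iic hxy).1 this).mono inter_subset_right
    · push Not at hex
      exact continuousWithinAt_singleton.mono fun y hy => le_antisymm hy.2 (hex y hy.1)
  refine (hl.union hr).mono fun y hy => ?_
  rcases le_total y x with h | h
  exacts [Or.inl ⟨hy, h⟩, Or.inr ⟨hy, h⟩]

namespace LocACDeriv

variable {I J : Set ℝ} {f f' g g' : ℝ → ℝ}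

lemma mono (h : LocACDeriv I f f') (hJ : J ⊆ I) : LocACDeriv J f f' :=
  ⟨h.locAC.mono hJ, ae_restrict_of_ae_restrict_of_subset hJ h.ae_hasDerivAt⟩

lemma congr_deriv {f'' : ℝ → ℝ} (h : LocACDeriv I f f')
    (h' : ∀ᵐ x ∂volume.restrict I, f' x = f'' x) : LocACDeriv I f f'' :=
  ⟨h.locAC, by filter_upwards [h.ae_hasDerivAt, h'] with x h₁ h₂ using h₂ ▸ h₁⟩

lemma continuousOn (h : LocACDeriv I f f') : ContinuousOn f I := h.locAC.continuousOn

/-- A locally absolutely continuous function has its classical derivative almost everywhere. -/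
lemma of_locAC (h : LocAC I f) : LocACDeriv I f (deriv f) := by
  refine ⟨h, ae_restrict_of_ae_restrict_inter_Ioo fun x y hx hy hxy => ?_⟩
  refine ae_restrict_of_ae_restrict_of_subset inter_subset_right ?_
  refine (ae_restrict_iff' measurableSet_Ioo).2 ?_
  filter_upwards [(h x hx y hy).ae_differentiableAt] with t ht htI
  exact (ht (Icc_subset_uIcc (Ioo_subset_Icc_self htI))).hasDerivAt

lemma const (c : ℝ) : LocACDeriv I (fun _ => c) (fun _ => 0) :=
  ⟨fun _ _ _ _ => contDiffOn_const.absolutelyContinuousOnInterval,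
    Eventually.of_forall fun x => hasDerivAt_const x c⟩

lemma add (hf : LocACDeriv I f f') (hg : LocACDeriv I g g') :
    LocACDeriv I (fun x => f x + g x) (fun x => f' x + g' x) :=
  ⟨fun x hx y hy => (hf.1 x hx y hy).fun_add (hg.1 x hx y hy), by
    filter_upwards [hf.2, hg.2] with x h₁ h₂ using h₁.add h₂⟩

lemma sub (hf : LocACDeriv I f f') (hg : LocACDeriv I g g') :
    LocACDeriv I (fun x => f x - g x) (fun x => f' x - g' x) :=
  ⟨fun x hx y hy => (hf.1 x hx y hy).fun_sub (hg.1 x hx y hy), by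
    filter_upwards [hf.2, hg.2] with x h₁ h₂ using h₁.sub h₂⟩

lemma mul (hf : LocACDeriv I f f') (hg : LocACDeriv I g g') :
    LocACDeriv I (fun x => f x * g x) (fun x => f' x * g x + f x * g' x) :=
  ⟨fun x hx y hy => (hf.1 x hx y hy).fun_mul (hg.1 x hx y hy), by
    filter_upwards [hf.2, hg.2] with x h₁ h₂ using h₁.mul h₂⟩

lemma const_mul (c : ℝ) (hf : LocACDeriv I f f') :
    LocACDeriv I (fun x => c * f x) (fun x => c * f' x) :=
  ((const c).mul hf).congr_deriv (by simp)

/-- Chain rule with a `C¹` outer function, which is Lipschitz on the compact interval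
`f '' uIcc x y`. -/
lemma comp [hI : I.OrdConnected] {F : ℝ → ℝ} (hf : LocACDeriv I f f')
    (hF : ∀ x ∈ I, ContDiffAt ℝ 1 F (f x)) :
    LocACDeriv I (fun x => F (f x)) (fun x => deriv F (f x) * f' x) := by
  refine ⟨fun x hx y hy => ?_, ?_⟩
  · have hAC := hf.1 x hx y hy
    have himg := hAC.continuousOn.image_uIcc
    have hC : ContDiffOn ℝ 1 F (f '' uIcc x y) := by
      rintro _ ⟨t, ht, rfl⟩
      exact (hF t (hI.uIcc_subset hx hy ht)).contDiffWithinAt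
    have hconv : Convex ℝ (f '' uIcc x y) := by rw [himg]; exact convex_Icc _ _
    obtain ⟨K, hK⟩ := hC.exists_lipschitzOnWith (by decide) hconv
      (isCompact_uIcc.image_of_continuousOn hAC.continuousOn)
    rw [absolutelyContinuousOnInterval_iff] at hAC ⊢
    intro ε hε
    obtain ⟨δ, hδ, H⟩ := hAC (ε / (K + 1)) (by positivity)
    refine ⟨δ, hδ, fun E hE hl => ?_⟩
    calc _ ≤ ∑ i ∈ Finset.range E.1, ((K : ℝ) + 1) * dist (f (E.2 i).1) (f (E.2 i).2) := by
          refine Finset.sum_le_sum fun i hi => ?_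
          have := hK.dist_le_mul _ (mem_image_of_mem f (hE.1 i hi).1) _
            (mem_image_of_mem f (hE.1 i hi).2)
          refine this.trans ?_
          gcongr
          simp
      _ < ε := by
          rw [← Finset.mul_sum]
          have := H E hE hl
          rwa [lt_div_iff₀ (by positivity), mul_comm] at this
  · have hmem : ∀ᵐ x ∂volume.restrict I, x ∈ I := ae_restrict_mem hI.measurableSet
    filter_upwards [hf.2, hmem] with x hx hxI
    exact ((hF x hxI).differentiableAt (by decide)).hasDerivAt.comp x hx

lemma div [hI : I.OrdConnected] (hf : LocACDeriv I f f') (hg : LocACDeriv I g g')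
    (h0 : ∀ x ∈ I, g x ≠ 0) :
    LocACDeriv I (fun x => f x / g x) (fun x => (f' x * g x - f x * g' x) / g x ^ 2) := by
  have hinv := hg.comp (F := fun t => t⁻¹) fun x hx => contDiffAt_inv ℝ (h0 x hx)
  refine ⟨by simpa only [div_eq_mul_inv] using (hf.mul hinv).1, ?_⟩
  filter_upwards [hf.2, hg.2, ae_restrict_mem hI.measurableSet] with x h₁ h₂ hx
  exact h₁.div h₂ (h0 x hx)

lemma exp [I.OrdConnected] (hf : LocACDeriv I f f') :
    LocACDeriv I (fun x => Real.exp (f x)) (fun x => Real.exp (f x) * f' x) := by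
  simpa using hf.comp (F := Real.exp) fun x _ => Real.contDiff_exp.contDiffAt

lemma log [I.OrdConnected] (hf : LocACDeriv I f f') (h0 : ∀ x ∈ I, f x ≠ 0) :
    LocACDeriv I (fun x => Real.log (f x)) (fun x => (f x)⁻¹ * f' x) := by
  simpa using hf.comp (F := Real.log) fun x hx => Real.contDiffAt_log.2 (h0 x hx)

lemma arctan [I.OrdConnected] (hf : LocACDeriv I f f') :
    LocACDeriv I (fun x => Real.arctan (f x)) (fun x => 1 / (1 + f x ^ 2) * f' x) := by
  simpa using hf.comp (F := Real.arctan) fun x _ => Real.contDiff_arctan.contDiffAt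

/-- The primitive of a locally integrable function. -/
lemma primitive [I.OrdConnected] {x₀ : ℝ} (hx₀ : x₀ ∈ I)
    (hf : ∀ x ∈ I, ∀ y ∈ I, IntervalIntegrable f volume x y) :
    LocACDeriv I (fun x => ∫ t in x₀..x, f t) f := by
  have key : ∀ x ∈ I, ∀ y ∈ I, ∃ s ∈ I, ∃ t ∈ I, x ∈ uIcc s t ∧ y ∈ uIcc s t ∧ x₀ ∈ uIcc s t := by
    intro x hx y hy
    have hmin : min x (min y x₀) ∈ I := by
      rcases min_choice x (min y x₀) with h | h
      · rwa [h]
      · rcases min_choice y x₀ with h' | h' <;> rwa [h, h']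
    have hmax : max x (max y x₀) ∈ I := by
      rcases max_choice x (max y x₀) with h | h
      · rwa [h]
      · rcases max_choice y x₀ with h' | h' <;> rwa [h, h']
    refine ⟨_, hmin, _, hmax, ?_, ?_, ?_⟩ <;> apply Icc_subset_uIcc <;> constructor <;> simp
  refine ⟨fun x hx y hy => ?_, ae_restrict_of_ae_restrict_inter_Ioo fun x y hx hy hxy => ?_⟩
  · obtain ⟨s, hs, t, ht, h₁, h₂, h₃⟩ := key x hx y hy
    exact ((hf s hs t ht).absolutelyContinuousOnInterval_intervalIntegral h₃).mono
      (uIcc_subset_uIcc h₁ h₂)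
  · obtain ⟨s, hs, t, ht, h₁, h₂, h₃⟩ := key x hx y hy
    refine ae_restrict_of_ae_restrict_of_subset inter_subset_right ?_
    refine (ae_restrict_iff' measurableSet_Ioo).2 ?_
    filter_upwards [(hf s hs t ht).ae_hasDerivAt_integral] with z hz hzI
    exact hz (uIcc_subset_uIcc h₁ h₂ (Icc_subset_uIcc (Ioo_subset_Icc_self hzI))) _ h₃

/-- Fundamental theorem of calculus. -/
lemma integral_eq_sub [hI : I.OrdConnected] (hf : LocACDeriv I f f') {x y : ℝ} (hx : x ∈ I)
    (hy : y ∈ I) : ∫ t in x..y, f' t = f y - f x := by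
  rw [← (hf.1 x hx y hy).integral_deriv_eq_sub]
  refine intervalIntegral.integral_congr_ae ?_
  have := (ae_restrict_iff' hI.measurableSet).1 hf.2
  filter_upwards [this] with t ht htI
  exact (ht (hI.uIcc_subset hx hy (uIoc_subset_uIcc htI))).deriv.symm

lemma le_of_nonneg [hI : I.OrdConnected] (hf : LocACDeriv I f f') {x y : ℝ} (hx : x ∈ I)
    (hy : y ∈ I) (hxy : x ≤ y) (h0 : ∀ᵐ t ∂volume.restrict (Ioo x y), 0 ≤ f' t) : f x ≤ f y := by
  have h := hf.integral_eq_sub hx hy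
  rw [intervalIntegral.integral_of_le hxy, integral_Ioc_eq_integral_Ioo] at h
  have := integral_nonneg_of_ae h0
  linarith

lemma lt_of_pos [hI : I.OrdConnected] (hf : LocACDeriv I f f') {x y : ℝ} (hx : x ∈ I)
    (hy : y ∈ I) (hxy : x < y) (h0 : ∀ᵐ t ∂volume.restrict (Ioo x y), 0 < f' t) : f x < f y := by
  refine lt_of_le_of_ne (hf.le_of_nonneg hx hy hxy.le (h0.mono fun _ h => h.le)) fun heq => ?_
  have hsub : Ioo x y ⊆ I := fun t ht => hI.out hx hy ⟨ht.1.le, ht.2.le⟩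
  -- monotone with equal end values, hence constant
  have hc : ∀ t ∈ Ioo x y, f t = f x := fun t ht => by
    refine le_antisymm (le_of_le_of_eq ?_ heq.symm) ?_
    · exact hf.le_of_nonneg (hsub ht) hy ht.2.le <|
        ae_restrict_of_ae_restrict_of_subset (Ioo_subset_Ioo_left ht.1.le)
          (h0.mono fun _ h => h.le)
    · exact hf.le_of_nonneg hx (hsub ht) ht.1.le <|
        ae_restrict_of_ae_restrict_of_subset (Ioo_subset_Ioo_right ht.2.le)
          (h0.mono fun _ h => h.le)
  have hne : NeBot (ae (volume.restrict (Ioo x y))) := by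
    rw [ae_neBot, Ne, Measure.restrict_eq_zero]
    simp [hxy]
  obtain ⟨t, h₁, h₂, h₃⟩ := ((h0.and ((ae_restrict_of_ae_restrict_of_subset hsub hf.2).and
    (ae_restrict_mem measurableSet_Ioo))).exists)
  have h₄ : HasDerivAt f 0 t := (hasDerivAt_const t (f x)).congr_of_eventuallyEq
    (by filter_upwards [isOpen_Ioo.mem_nhds h₃] with s hs using hc s hs)
  exact h₁.ne' (h₂.unique h₄)

end LocACDeriv

/-! ### Linear systems with locally integrable coefficients -/

section Volterra

open scoped BoundedContinuousFunction

variable {J : Set ℝ} {x₀ : ℝ} {k A : ℝ → ℝ}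

/-- Extension by zero of a function on the subtype `J` to the real line, so that it can be
integrated. -/
noncomputable def extendZero (J : Set ℝ) (F : J → ℝ) (t : ℝ) : ℝ :=
  Function.extend Subtype.val F 0 t

lemma extendZero_coe (F : J → ℝ) (x : J) : extendZero J F x = F x :=
  Subtype.val_injective.extend_apply F 0 x

lemma continuousOn_extendZero (F : J →ᵇ ℝ) : ContinuousOn (extendZero J F) J := by
  rw [continuousOn_iff_continuous_domRestrict]
  convert! F.continuous using 1
  ext x
  exact extendZero_coe F x

lemma abs_integral_le_of_subset [hJ : J.OrdConnected] {f : ℝ → ℝ} {x y : ℝ} (hx : x ∈ J)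
    (hy : y ∈ J) {g : ℝ → ℝ} (hg : IntervalIntegrable g volume x y)
    (h : ∀ t ∈ J, |f t| ≤ g t) : |∫ t in x..y, f t| ≤ |∫ t in x..y, g t| := by
  refine intervalIntegral.norm_integral_le_abs_of_norm_le (f := f) ?_ hg
  filter_upwards [ae_restrict_mem measurableSet_uIoc] with t ht using
    h t (hJ.uIcc_subset hx hy (uIoc_subset_uIcc ht))

/-- With `m x = ∫_{x₀}^x k`, the function `k e^{2|m|}` is, up to a sign, the derivative of
`e^{2|m|} / 2`. -/
lemma abs_integral_mul_exp_le [hJ : J.OrdConnected] (hx₀ : x₀ ∈ J) (hk0 : ∀ t, 0 ≤ k t)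
    (hk : ∀ x ∈ J, ∀ y ∈ J, IntervalIntegrable k volume x y) {x : ℝ} (hx : x ∈ J) :
    |∫ t in x₀..x, k t * Real.exp (2 * |∫ s in x₀..t, k s|)| ≤
      Real.exp (2 * |∫ s in x₀..x, k s|) / 2 := by
  have hm := LocACDeriv.primitive hx₀ hk
  rcases le_total x₀ x with h | h
  · have hpos : ∀ t, x₀ ≤ t → |∫ s in x₀..t, k s| = ∫ s in x₀..t, k s := fun t ht =>
      abs_of_nonneg (intervalIntegral.integral_nonneg ht fun s _ => hk0 s)
    have hFTC := ((hm.const_mul 2).exp.const_mul (1 / 2)).integral_eq_sub hx₀ hx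
    have : ∫ t in x₀..x, k t * Real.exp (2 * |∫ s in x₀..t, k s|) =
        Real.exp (2 * |∫ s in x₀..x, k s|) / 2 - 1 / 2 := by
      rw [hpos x h]
      simp only [intervalIntegral.integral_same, mul_zero, Real.exp_zero] at hFTC
      rw [show ∀ z : ℝ, z / 2 - 1 / 2 = 1 / 2 * z - 1 / 2 * 1 by intro z; ring, ← hFTC]
      refine intervalIntegral.integral_congr fun t ht => ?_
      rw [uIcc_of_le h] at ht
      simp only [hpos t ht.1]
      ring
    rw [this, abs_of_nonneg]
    · linarith
    · have := Real.one_le_exp (x := 2 * |∫ s in x₀..x, k s|) (by positivity)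
      linarith
  · have hneg : ∀ t, t ≤ x₀ → |∫ s in x₀..t, k s| = -∫ s in x₀..t, k s := fun t ht => by
      refine abs_of_nonpos ?_
      rw [intervalIntegral.integral_symm]
      exact neg_nonpos.2 (intervalIntegral.integral_nonneg ht fun s _ => hk0 s)
    have hFTC := ((hm.const_mul (-2)).exp.const_mul (1 / 2)).integral_eq_sub hx₀ hx
    have : ∫ t in x₀..x, k t * Real.exp (2 * |∫ s in x₀..t, k s|) =
        -(Real.exp (2 * |∫ s in x₀..x, k s|) / 2 - 1 / 2) := by
      rw [hneg x h]
      simp only [intervalIntegral.integral_same, mul_zero, Real.exp_zero] at hFTC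
      rw [show ∀ z : ℝ, 2 * -z = -2 * z by intro z; ring,
        show ∀ z : ℝ, -(z / 2 - 1 / 2) = -(1 / 2 * z - 1 / 2 * 1) by intro z; ring, ← hFTC,
        ← intervalIntegral.integral_neg]
      refine intervalIntegral.integral_congr fun t ht => ?_
      rw [uIcc_of_ge h] at ht
      simp only [hneg t ht.2]
      rw [show ∀ z : ℝ, 2 * -z = -2 * z by intro z; ring]
      ring
    rw [this, abs_neg, abs_of_nonneg]
    · linarith
    · have := Real.one_le_exp (x := 2 * |∫ s in x₀..x, k s|) (by positivity)
      linarith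

/-- The integral operator `F ↦ e^{-2|m|} (y₀ + ∫_{x₀} A e^{2|m|} F)`, `m = ∫_{x₀} k`, acts on the
bounded continuous functions on `J` and halves distances as soon as `|A| ≤ k`. -/
lemma exists_volterra_operator [hJ : J.OrdConnected] (hx₀ : x₀ ∈ J) (hk0 : ∀ t, 0 ≤ k t)
    (hk : ∀ x ∈ J, ∀ y ∈ J, IntervalIntegrable k volume x y)
    (hA : ∀ x ∈ J, ∀ y ∈ J, IntervalIntegrable A volume x y) (hAk : ∀ t, |A t| ≤ k t) (y₀ : ℝ) :
    ∃ T : (J →ᵇ ℝ) → (J →ᵇ ℝ), (∀ F G, dist (T F) (T G) ≤ 1 / 2 * dist F G) ∧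
      ∀ (F : J →ᵇ ℝ) (x : J), Real.exp (2 * |∫ s in x₀..(x : ℝ), k s|) * T F x =
        y₀ + ∫ t in x₀..x, A t * (Real.exp (2 * |∫ s in x₀..t, k s|) * extendZero J F t) := by
  have hm := (LocACDeriv.primitive hx₀ hk).continuousOn
  have hw : ContinuousOn (fun t => Real.exp (2 * |∫ s in x₀..t, k s|)) J := by fun_prop
  have hint : ∀ h : ℝ → ℝ, ContinuousOn h J → ∀ x ∈ J, ∀ y ∈ J, IntervalIntegrable
      (fun t => A t * (Real.exp (2 * |∫ s in x₀..t, k s|) * h t)) volume x y :=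
    fun h hh x hx y hy => (hA x hx y hy).mul_continuousOn
      ((hw.mul hh).mono (hJ.uIcc_subset hx hy))
  have hbd : ∀ (h : ℝ → ℝ) (C : ℝ), (∀ t ∈ J, |h t| ≤ C) → ∀ x ∈ J,
      |∫ t in x₀..x, A t * (Real.exp (2 * |∫ s in x₀..t, k s|) * h t)| ≤
        C * (Real.exp (2 * |∫ s in x₀..x, k s|) / 2) := by
    intro h C hC x hx
    have hC0 : 0 ≤ C := (abs_nonneg _).trans (hC x hx)
    refine (abs_integral_le_of_subset hx₀ hx
      (g := fun t => C * (k t * Real.exp (2 * |∫ s in x₀..t, k s|))) ?_ ?_).trans ?_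
    · exact ((hk _ hx₀ x hx).mul_continuousOn (hw.mono (hJ.uIcc_subset hx₀ hx))).const_mul C
    · intro t ht
      rw [abs_mul, abs_mul, Real.abs_exp]
      calc _ ≤ k t * (Real.exp (2 * |∫ s in x₀..t, k s|) * C) := by
            gcongr
            exacts [hk0 t, hAk t, hC t ht]
        _ = _ := by ring
    · rw [intervalIntegral.integral_const_mul, abs_mul, abs_of_nonneg hC0]
      gcongr
      exact abs_integral_mul_exp_le hx₀ hk0 hk hx
  have hcont : ∀ F : J →ᵇ ℝ, Continuous fun x : J => Real.exp (-(2 * |∫ s in x₀..(x : ℝ), k s|)) *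
      (y₀ + ∫ t in x₀..x, A t * (Real.exp (2 * |∫ s in x₀..t, k s|) * extendZero J F t)) := by
    intro F
    have h₁ := (LocACDeriv.primitive hx₀ (hint _ (continuousOn_extendZero F))).continuousOn
    have : ContinuousOn (fun x : ℝ => Real.exp (-(2 * |∫ s in x₀..(x : ℝ), k s|)) *
      (y₀ + ∫ t in x₀..x, A t * (Real.exp (2 * |∫ s in x₀..t, k s|) * extendZero J F t))) J := by
      fun_prop
    exact continuousOn_iff_continuous_domRestrict.1 this
  have hF : ∀ F : J →ᵇ ℝ, ∀ t ∈ J, |extendZero J F t| ≤ ‖F‖ := fun F t ht => by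
    rw [extendZero_coe F ⟨t, ht⟩]
    exact F.norm_coe_le_norm _
  have hhalf : ∀ C z : ℝ, Real.exp (-z) * (C * (Real.exp z / 2)) = C / 2 := fun C z => by
    rw [Real.exp_neg]
    field_simp
  have hbdd : ∀ (F : J →ᵇ ℝ) (x : J), ‖Real.exp (-(2 * |∫ s in x₀..(x : ℝ), k s|)) *
      (y₀ + ∫ t in x₀..x, A t * (Real.exp (2 * |∫ s in x₀..t, k s|) * extendZero J F t))‖ ≤
        |y₀| + ‖F‖ / 2 := by
    intro F x
    rw [Real.norm_eq_abs, abs_mul, Real.abs_exp]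
    have h₁ := hbd _ _ (hF F) x x.2
    calc _ ≤ Real.exp (-(2 * |∫ s in x₀..(x : ℝ), k s|)) *
          (|y₀| + ‖F‖ * (Real.exp (2 * |∫ s in x₀..(x : ℝ), k s|) / 2)) := by
          gcongr
          exact (abs_add_le _ _).trans (by gcongr)
      _ = Real.exp (-(2 * |∫ s in x₀..(x : ℝ), k s|)) * |y₀| + ‖F‖ / 2 := by rw [mul_add, hhalf]
      _ ≤ _ := by
          gcongr
          refine mul_le_of_le_one_left (abs_nonneg _) (Real.exp_le_one_iff.2 ?_)
          simp
  refine ⟨fun F => BoundedContinuousFunction.ofNormedAddCommGroup _ (hcont F) _ (hbdd F), ?_, ?_⟩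
  · intro F G
    refine (BoundedContinuousFunction.dist_le (by positivity)).2 fun x => ?_
    simp only [BoundedContinuousFunction.coe_ofNormedAddCommGroup]
    rw [Real.dist_eq, ← mul_sub, add_sub_add_left_eq_sub, ← intervalIntegral.integral_sub
      (hint _ (continuousOn_extendZero F) _ hx₀ _ x.2)
      (hint _ (continuousOn_extendZero G) _ hx₀ _ x.2), abs_mul, Real.abs_exp]
    simp only [← mul_sub]
    have h₁ := hbd (fun t => extendZero J F t - extendZero J G t) (dist F G) (fun t ht => by
      rw [extendZero_coe F ⟨t, ht⟩, extendZero_coe G ⟨t, ht⟩]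
      exact BoundedContinuousFunction.dist_coe_le_dist (f := F) (g := G) _) x x.2
    calc _ ≤ Real.exp (-(2 * |∫ s in x₀..(x : ℝ), k s|)) *
          (dist F G * (Real.exp (2 * |∫ s in x₀..(x : ℝ), k s|) / 2)) := by gcongr
      _ = _ := by rw [hhalf]; ring
  · intro F x
    simp only [BoundedContinuousFunction.coe_ofNormedAddCommGroup]
    rw [← mul_assoc, ← Real.exp_add]
    simp

end Volterra

section LinearSystem

variable {J : Set ℝ} {x₀ : ℝ} {A B : ℝ → ℝ}

/-- Carathéodory solvability of `y' = A z`, `z' = B y` with locally integrable coefficients, on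
all of an interval `J`. -/
theorem exists_solution_linear_system [hJ : J.OrdConnected] (hx₀ : x₀ ∈ J)
    (hA : ∀ x ∈ J, ∀ y ∈ J, IntervalIntegrable A volume x y)
    (hB : ∀ x ∈ J, ∀ y ∈ J, IntervalIntegrable B volume x y) (y₀ z₀ : ℝ) :
    ∃ y z : ℝ → ℝ, LocACDeriv J y (fun x => A x * z x) ∧ LocACDeriv J z (fun x => B x * y x) ∧
      y x₀ = y₀ ∧ z x₀ = z₀ := by
  set k : ℝ → ℝ := fun t => |A t| + |B t|
  have hk0 : ∀ t, 0 ≤ k t := fun t => by positivity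
  have hk : ∀ x ∈ J, ∀ y ∈ J, IntervalIntegrable k volume x y :=
    fun x hx y hy => (hA x hx y hy).abs.add (hB x hx y hy).abs
  obtain ⟨S, hS, hS'⟩ := exists_volterra_operator hx₀ hk0 hk hA
    (fun t => le_add_of_nonneg_right (abs_nonneg _)) y₀
  obtain ⟨T, hT, hT'⟩ := exists_volterra_operator hx₀ hk0 hk hB
    (fun t => le_add_of_nonneg_left (abs_nonneg _)) z₀
  have hcontr : ContractingWith (1 / 2) (fun F : BoundedContinuousFunction J ℝ ×
      BoundedContinuousFunction J ℝ => (S F.2, T F.1)) := by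
    refine ⟨by rw [← NNReal.coe_lt_coe]; norm_num, LipschitzWith.of_dist_le_mul fun F G => ?_⟩
    rw [Prod.dist_eq, Prod.dist_eq]
    push_cast
    refine max_le ((hS _ _).trans ?_) ((hT _ _).trans ?_)
    · gcongr
      exact le_max_right _ _
    · gcongr
      exact le_max_left _ _
  have hfix := hcontr.fixedPoint_isFixedPt
  set F := ContractingWith.fixedPoint _ hcontr
  have hF₁ : S F.2 = F.1 := congrArg Prod.fst hfix
  have hF₂ : T F.1 = F.2 := congrArg Prod.snd hfix
  set w : ℝ → ℝ := fun t => Real.exp (2 * |∫ s in x₀..t, k s|) with hwdef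
  have hw : ContinuousOn w J := by
    have hm := (LocACDeriv.primitive hx₀ hk).continuousOn
    fun_prop
  have hy := LocACDeriv.primitive hx₀ fun x hx y hy => (hA x hx y hy).mul_continuousOn
    ((hw.mul (continuousOn_extendZero F.2)).mono (hJ.uIcc_subset hx hy))
  have hz := LocACDeriv.primitive hx₀ fun x hx y hy => (hB x hx y hy).mul_continuousOn
    ((hw.mul (continuousOn_extendZero F.1)).mono (hJ.uIcc_subset hx hy))
  refine ⟨_, _, ((LocACDeriv.const y₀).add hy).congr_deriv ?_,
    ((LocACDeriv.const z₀).add hz).congr_deriv ?_, by simp, by simp⟩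
  · filter_upwards [ae_restrict_mem hJ.measurableSet] with x hx
    have := hT' F.1 ⟨x, hx⟩
    rw [hF₂] at this
    simp only [hwdef, Pi.mul_apply, zero_add, ← this, extendZero_coe F.2 ⟨x, hx⟩]
  · filter_upwards [ae_restrict_mem hJ.measurableSet] with x hx
    have := hS' F.2 ⟨x, hx⟩
    rw [hF₁] at this
    simp only [hwdef, Pi.mul_apply, zero_add, ← this, extendZero_coe F.1 ⟨x, hx⟩]

/-- Uniqueness for the zero initial value: with `m = ∫_{x₀} (|A| + |B|)`, the function
`(y² + z²) e^m` is nondecreasing and `(y² + z²) e^{-m}` is nonincreasing. -/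
lemma sq_add_sq_pos_of_linear_system [hJ : J.OrdConnected] (hx₀ : x₀ ∈ J)
    (hA : ∀ x ∈ J, ∀ y ∈ J, IntervalIntegrable A volume x y)
    (hB : ∀ x ∈ J, ∀ y ∈ J, IntervalIntegrable B volume x y) {y z : ℝ → ℝ}
    (hy : LocACDeriv J y (fun x => A x * z x)) (hz : LocACDeriv J z (fun x => B x * y x))
    (h0 : 0 < y x₀ ^ 2 + z x₀ ^ 2) {x : ℝ} (hx : x ∈ J) : 0 < y x ^ 2 + z x ^ 2 := by
  have hk : ∀ x ∈ J, ∀ y ∈ J, IntervalIntegrable (fun t => |A t| + |B t|) volume x y :=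
    fun x hx y hy => (hA x hx y hy).abs.add (hB x hx y hy).abs
  have hm := LocACDeriv.primitive hx₀ hk
  have hN := (hy.mul hy).add (hz.mul hz)
  have key : ∀ A B y z : ℝ, |A * z * y + y * (A * z) + (B * y * z + z * (B * y))| ≤
      (y * y + z * z) * (|A| + |B|) := by
    intro A B y z
    rw [show A * z * y + y * (A * z) + (B * y * z + z * (B * y)) = (2 * y * z) * (A + B) by ring,
      abs_mul]
    refine mul_le_mul (abs_le.2 ⟨?_, ?_⟩) (abs_add_le A B) (abs_nonneg _)
      (add_nonneg (mul_self_nonneg y) (mul_self_nonneg z))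
    · nlinarith [sq_nonneg (y + z)]
    · nlinarith [sq_nonneg (y - z)]
  rcases le_total x₀ x with h | h
  · have := (hN.mul hm.exp).le_of_nonneg hx₀ hx h (Eventually.of_forall fun t => by
      have h₁ := neg_le_of_abs_le (key (A t) (B t) (y t) (z t))
      have h₂ := Real.exp_pos (∫ s in x₀..t, (|A s| + |B s|))
      nlinarith)
    simp only [intervalIntegral.integral_same, Real.exp_zero] at this
    have h₁ : 0 < y x * y x + z x * z x :=
      pos_of_mul_pos_left (lt_of_lt_of_le (by linarith) this) (Real.exp_pos _).le
    linarith
  · have := ((hN.mul (hm.const_mul (-1)).exp).const_mul (-1)).le_of_nonneg hx hx₀ h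
      (Eventually.of_forall fun t => by
      have h₁ := le_of_abs_le (key (A t) (B t) (y t) (z t))
      have h₂ := Real.exp_pos (-1 * ∫ s in x₀..t, (|A s| + |B s|))
      nlinarith)
    simp only [intervalIntegral.integral_same, mul_zero, Real.exp_zero] at this
    have h₁ : 0 < y x * y x + z x * z x :=
      pos_of_mul_pos_left (b := Real.exp (-1 * ∫ s in x₀..x, (|A s| + |B s|))) (by linarith)
        (Real.exp_pos _).le
    linarith

/-- At a zero of `y` the second component `z` does not vanish, so `y` is strictly monotone near
that zero. Zeros are therefore isolated. -/
lemma finite_zeros_of_linear_system [hJ : J.OrdConnected]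
    (hApos : ∀ᵐ x ∂volume.restrict J, 0 < A x) {y z : ℝ → ℝ}
    (hy : LocACDeriv J y (fun x => A x * z x)) (hz : ContinuousOn z J)
    (h0 : ∀ x ∈ J, 0 < y x ^ 2 + z x ^ 2) {α β : ℝ} (hαβ : Icc α β ⊆ J) :
    {x ∈ Icc α β | y x = 0}.Finite := by
  by_contra hinf
  obtain ⟨ξ, hξ, hacc⟩ := Set.Infinite.exists_accPt_of_subset_isCompact hinf isCompact_Icc
    (sep_subset _ _)
  have hξJ := hαβ hξ
  have hfreq := accPt_iff_frequently_nhdsNE.1 hacc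
  have hle : 𝓝[Icc α β] ξ ≤ 𝓝[J] ξ := nhdsWithin_mono _ hαβ
  have hyξ : y ξ = 0 := by
    by_contra hne
    have h₁ : ∀ᶠ x in 𝓝[Icc α β] ξ, y x ≠ 0 :=
      ((hy.continuousOn ξ hξJ).mono hαβ).eventually_ne hne
    refine hfreq ?_
    filter_upwards [nhdsWithin_le_nhds (eventually_nhdsWithin_iff.1 h₁)] with x hx hx'
    exact hx hx'.1 hx'.2
  have hzξ : z ξ ≠ 0 := fun h => by simpa [hyξ, h] using h0 ξ hξJ
  -- after a change of sign of `y` and `z`, the value `z ξ` is positive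
  have main : ∀ y z : ℝ → ℝ, LocACDeriv J y (fun x => A x * z x) → ContinuousOn z J → y ξ = 0 →
      0 < z ξ → ∀ᶠ x in 𝓝[≠] ξ, x ∈ Icc α β → y x ≠ 0 := by
    intro y z hy hz hyξ hzξ
    have h₁ : ∀ᶠ x in 𝓝 ξ, x ∈ J → 0 < z x :=
      eventually_nhdsWithin_iff.1 ((hz ξ hξJ).eventually (lt_mem_nhds hzξ))
    obtain ⟨ε, hε, hball⟩ := Metric.eventually_nhds_iff.1 h₁
    have hpos : ∀ s ∈ J, ∀ t ∈ J, dist s ξ < ε → dist t ξ < ε → s < t → y s < y t := by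
      intro s hs t ht hsε htε hst
      refine hy.lt_of_pos hs ht hst ?_
      have hsub : Ioo s t ⊆ J := fun r hr => hJ.out hs ht ⟨hr.1.le, hr.2.le⟩
      filter_upwards [ae_restrict_of_ae_restrict_of_subset hsub hApos,
        ae_restrict_mem measurableSet_Ioo] with r hr hrI
      refine mul_pos hr (hball ?_ (hsub hrI))
      rw [Real.dist_eq, abs_lt] at *
      exact ⟨by linarith [hrI.1], by linarith [hrI.2]⟩
    rw [eventually_nhdsWithin_iff]
    filter_upwards [Metric.ball_mem_nhds ξ hε] with x hxb hxne hx
    rcases lt_or_gt_of_ne hxne with h | h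
    · have := hpos x (hαβ hx) ξ hξJ hxb (by simpa using hε) h
      exact fun h' => by linarith
    · have := hpos ξ hξJ x (hαβ hx) (by simpa using hε) hxb h
      exact fun h' => by linarith
  refine hfreq ?_
  rcases lt_or_gt_of_ne hzξ with h | h
  · have := main (fun x => -1 * y x) (fun x => -1 * z x)
      ((hy.const_mul (-1)).congr_deriv (Eventually.of_forall fun x => by ring))
      (by fun_prop) (by simp [hyξ]) (by linarith)
    filter_upwards [this] with x hx hx'
    exact hx hx'.1 (by simp [hx'.2])
  · filter_upwards [main y z hy hz hyξ h] with x hx hx' using hx hx'.1 hx'.2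

/-- If both components of `(g, e)` have nonnegative derivatives as long as `g, e ≥ 0`, then `(g, e)`
cannot leave the open positive quadrant, because both components are nondecreasing there. -/
lemma pos_of_nonneg_deriv [hJ : J.OrdConnected] (hleft : ∀ x ∈ J, x₀ ≤ x) (hx₀ : x₀ ∈ J)
    {g g' e e' : ℝ → ℝ} (hg : LocACDeriv J g g') (he : LocACDeriv J e e')
    (h : ∀ᵐ x ∂volume.restrict J, 0 ≤ g x → 0 ≤ e x → 0 ≤ g' x ∧ 0 ≤ e' x)
    (hg0 : 0 < g x₀) (he0 : 0 < e x₀) {x : ℝ} (hx : x ∈ J) : 0 < g x := by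
  by_contra hneg
  have hsub : Icc x₀ x ⊆ J := fun t ht => hJ.out hx₀ hx ht
  set S := {t ∈ Icc x₀ x | min (g t) (e t) ≤ 0} with hS
  have hSne : S.Nonempty := ⟨x, ⟨hleft x hx, le_rfl⟩, (min_le_left _ _).trans (not_lt.1 hneg)⟩
  have hScl : IsClosed S := by
    have hc : ContinuousOn (fun t => min (g t) (e t)) (Icc x₀ x) :=
      (hg.continuousOn.mono hsub).inf (he.continuousOn.mono hsub)
    exact hc.preimage_isClosed_of_isClosed isClosed_Icc isClosed_Iic
  have hbdd : BddBelow S := ⟨x₀, fun t ht => ht.1.1⟩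
  have hmem := hScl.csInf_mem hSne hbdd
  set t := sInf S
  have hpos : ∀ᵐ r ∂volume.restrict (Ioo x₀ t), 0 ≤ g' r ∧ 0 ≤ e' r := by
    have hsub' : Ioo x₀ t ⊆ J := fun r hr => hsub ⟨hr.1.le, hr.2.le.trans hmem.1.2⟩
    filter_upwards [ae_restrict_of_ae_restrict_of_subset hsub' h,
      ae_restrict_mem measurableSet_Ioo] with r hr hrI
    have hrS : r ∉ S := fun hrS => (csInf_le hbdd hrS).not_gt hrI.2
    have hmin : 0 < min (g r) (e r) := by
      by_contra hc
      exact hrS ⟨⟨hrI.1.le, hrI.2.le.trans hmem.1.2⟩, not_lt.1 hc⟩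
    exact hr (hmin.trans_le (min_le_left _ _)).le (hmin.trans_le (min_le_right _ _)).le
  have h₁ := hg.le_of_nonneg hx₀ (hsub hmem.1) hmem.1.1 (hpos.mono fun _ h => h.1)
  have h₂ := he.le_of_nonneg hx₀ (hsub hmem.1) hmem.1.1 (hpos.mono fun _ h => h.2)
  exact hmem.2.not_gt (lt_min (hg0.trans_le h₁) (he0.trans_le h₂))

end LinearSystem

/-! ### Comparison in renormalized variables -/

/-- The linear system `g' = s (-ε₁ g + (1 - ε₂) h)`, `h' = s (D g + ε₁ h + h)` on `I`. With `s dx`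
as new independent variable, it is a small perturbation of an Euler equation with
coefficient `D`. -/
structure RenormalizedSystem (I : Set ℝ) (s ε₁ ε₂ D g h : ℝ → ℝ) : Prop where
  fst : LocACDeriv I g (fun x => s x * (-ε₁ x * g x + (1 - ε₂ x) * h x))
  snd : LocACDeriv I h (fun x => s x * (D x * g x + ε₁ x * h x + h x))

/-- If `y` solves the perturbed equation, then `g = y / u` and `h = φ (u z - w y)`, that is `φ`
times the modified Wronskian of `u` and `y`, solve the renormalized system with
`s = φ' / φ`. -/
lemma renormalizedSystem_of_solutions {I : Set ℝ} [hI : I.OrdConnected]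
    {p₀ p₁ Q₀ Q₁ u w φ y z s ε₁ ε₂ D : ℝ → ℝ}
    (hp₀ : ∀ᵐ x ∂volume.restrict I, 0 < p₀ x) (hp₁ : ∀ᵐ x ∂volume.restrict I, 0 < p₁ x)
    (hu0 : ∀ x ∈ I, 0 < u x) (hφ0 : ∀ x ∈ I, 0 < φ x)
    (hu : LocACDeriv I u (fun x => 1 / p₀ x * w x)) (hw : LocACDeriv I w (fun x => Q₀ x * u x))
    (hφ : LocACDeriv I φ (fun x => 1 / (p₀ x * u x ^ 2)))
    (hy : LocACDeriv I y (fun x => 1 / p₁ x * z x)) (hz : LocACDeriv I z (fun x => Q₁ x * y x))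
    (hs : ∀ᵐ x ∂volume.restrict I, s x = 1 / (p₀ x * u x ^ 2 * φ x))
    (hε₁ : ∀ᵐ x ∂volume.restrict I, ε₁ x = u x * φ x * w x * ((p₁ x - p₀ x) / p₁ x))
    (hε₂ : ∀ᵐ x ∂volume.restrict I, ε₂ x = (p₁ x - p₀ x) / p₁ x)
    (hD : ∀ᵐ x ∂volume.restrict I, D x = p₀ x * (u x * φ x) ^ 2 *
      (u x ^ 2 * (Q₁ x - Q₀ x) + w x ^ 2 * ((p₁ x - p₀ x) / (p₁ x * p₀ x)))) :
    RenormalizedSystem I s ε₁ ε₂ D (fun x => y x / u x)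
      (fun x => φ x * (u x * z x - w x * y x)) := by
  have hmem := ae_restrict_mem (μ := volume) hI.measurableSet
  constructor
  · refine (hy.div hu fun x hx => (hu0 x hx).ne').congr_deriv ?_
    filter_upwards [hp₀, hp₁, hs, hε₁, hε₂, hmem] with x h₀ h₁ hs h₂ h₃ hx
    have := hu0 x hx
    have := hφ0 x hx
    rw [hs, h₂, h₃]
    field_simp
    ring
  · refine (hφ.mul ((hu.mul hz).sub (hw.mul hy))).congr_deriv ?_
    filter_upwards [hp₀, hp₁, hs, hε₁, hε₂, hD, hmem] with x h₀ h₁ hs h₂ h₃ h₄ hx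
    have := hu0 x hx
    have := hφ0 x hx
    rw [hs, h₂, h₄]
    field_simp
    ring

/-- Completing the square: if `D ≤ -1/4 - η`, the right-hand side of the Riccati equation stays
below a negative multiple of `1 + R²`. -/
lemma riccati_rhs_le {η ε e₁ e₂ D R : ℝ} (hε : ε ≤ 1 / 8) (hεη : ε ≤ η / 8)
    (h₁ : |e₁| ≤ ε) (h₂ : |e₂| ≤ ε) (hD : D ≤ -1 / 4 - η) :
    D + R + 2 * e₁ * R - (1 - e₂) * R ^ 2 ≤ -(min (1 / 4) (η / 2)) * (1 + R ^ 2) := by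
  have hε0 : 0 ≤ ε := (abs_nonneg _).trans h₁
  have h₃ : 2 * e₁ * R ≤ ε * (1 + R ^ 2) := by
    have h : e₁ * R ≤ ε * |R| := by
      calc e₁ * R ≤ |e₁ * R| := le_abs_self _
        _ = |e₁| * |R| := abs_mul _ _
        _ ≤ _ := by gcongr
    nlinarith [sq_nonneg (|R| - 1), sq_abs R]
  have h₄ : e₂ * R ^ 2 ≤ ε * R ^ 2 := by
    gcongr
    exact le_of_abs_le h₂
  have hκ₁ := min_le_left (1 / 4) (η / 2)
  have hκ₂ := min_le_right (1 / 4) (η / 2)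
  set κ := min (1 / 4) (η / 2)
  have h₅ : R ^ 2 ≤ 2 * (R - 1 / 2) ^ 2 + 1 / 2 := by nlinarith [sq_nonneg (R - 1)]
  have hκ0 : 0 ≤ κ := le_min (by norm_num) (by linarith)
  have h₆ : ε * R ^ 2 ≤ ε * (2 * (R - 1 / 2) ^ 2 + 1 / 2) := by gcongr
  have h₇ : κ * R ^ 2 ≤ κ * (2 * (R - 1 / 2) ^ 2 + 1 / 2) := by gcongr
  have h₈ : ε * (R - 1 / 2) ^ 2 ≤ 1 / 8 * (R - 1 / 2) ^ 2 := by gcongr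
  have h₉ : κ * (R - 1 / 2) ^ 2 ≤ 1 / 4 * (R - 1 / 2) ^ 2 := by gcongr
  nlinarith

/-- Oscillatory case: as long as `g` has no zero, `R = h / g` satisfies a Riccati inequality
`R' ≤ -κ s (1 + R²)`. Then `arctan R + κ ∫ s` is nonincreasing, which bounds `∫ s`. -/
lemma RenormalizedSystem.bddAbove_of_ne_zero {J : Set ℝ} [hJ : J.OrdConnected] {x₀ : ℝ}
    (hx₀ : x₀ ∈ J) (hleft : ∀ x ∈ J, x₀ ≤ x) {s ε₁ ε₂ D g h L : ℝ → ℝ}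
    (hsys : RenormalizedSystem J s ε₁ ε₂ D g h) (hL : LocACDeriv J L s)
    (hs : ∀ᵐ x ∂volume.restrict J, 0 ≤ s x) {η ε : ℝ} (hη : 0 < η) (hε : ε ≤ 1 / 8)
    (hεη : ε ≤ η / 8) (h₁ : ∀ᵐ x ∂volume.restrict J, |ε₁ x| ≤ ε)
    (h₂ : ∀ᵐ x ∂volume.restrict J, |ε₂ x| ≤ ε)
    (hD : ∀ᵐ x ∂volume.restrict J, D x ≤ -1 / 4 - η) (hg : ∀ x ∈ J, g x ≠ 0) :
    ∃ M, ∀ x ∈ J, L x ≤ M := by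
  set κ := min (1 / 4) (η / 2) with hκ
  have hκ0 : 0 < κ := lt_min (by norm_num) (by linarith)
  have hV := ((hsys.snd.div hsys.fst hg).arctan.add (hL.const_mul κ)).const_mul (-1)
  have hV' : ∀ᵐ x ∂volume.restrict J, 0 ≤ -1 * (1 / (1 + (h x / g x) ^ 2) *
      ((s x * (D x * g x + ε₁ x * h x + h x) * g x -
        h x * (s x * (-ε₁ x * g x + (1 - ε₂ x) * h x))) / g x ^ 2) + κ * s x) := by
    filter_upwards [hs, h₁, h₂, hD, ae_restrict_mem hJ.measurableSet] with x hs h₁ h₂ hD hx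
    have hgx := hg x hx
    have hR : (s x * (D x * g x + ε₁ x * h x + h x) * g x -
        h x * (s x * (-ε₁ x * g x + (1 - ε₂ x) * h x))) / g x ^ 2 =
        s x * (D x + h x / g x + 2 * ε₁ x * (h x / g x) - (1 - ε₂ x) * (h x / g x) ^ 2) := by
      field_simp
      ring
    rw [hR]
    have hric := riccati_rhs_le (R := h x / g x) hε hεη h₁ h₂ hD
    rw [← hκ] at hric
    set R := h x / g x
    have hpos : 0 < 1 + R ^ 2 := by positivity
    have h₃ : s x * (D x + R + 2 * ε₁ x * R - (1 - ε₂ x) * R ^ 2) ≤ s x * (-κ * (1 + R ^ 2)) := by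
      gcongr
    have h₄ : 1 / (1 + R ^ 2) * (s x * (D x + R + 2 * ε₁ x * R - (1 - ε₂ x) * R ^ 2)) ≤
        1 / (1 + R ^ 2) * (s x * (-κ * (1 + R ^ 2))) := by gcongr
    have h₅ : 1 / (1 + R ^ 2) * (s x * (-κ * (1 + R ^ 2))) = -(κ * s x) := by field_simp
    linarith
  refine ⟨(Real.arctan (h x₀ / g x₀) + κ * L x₀ + Real.pi) / κ, fun x hx => ?_⟩
  have hle := hV.le_of_nonneg hx₀ hx (hleft x hx) <| ae_restrict_of_ae_restrict_of_subset
    (fun t ht => hJ.out hx₀ hx ⟨ht.1.le, ht.2.le⟩) hV'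
  rw [le_div_iff₀ hκ0]
  have := Real.neg_pi_div_two_lt_arctan (h x / g x)
  have := Real.pi_pos
  linarith

/-- Nonoscillatory case: in the variables `g` and `h - g / 2` the system has nonnegative
coefficients. -/
lemma RenormalizedSystem.pos {J : Set ℝ} [hJ : J.OrdConnected] {x₀ : ℝ}
    (hx₀ : x₀ ∈ J) (hleft : ∀ x ∈ J, x₀ ≤ x) {s ε₁ ε₂ D g h : ℝ → ℝ}
    (hsys : RenormalizedSystem J s ε₁ ε₂ D g h)
    (hs : ∀ᵐ x ∂volume.restrict J, 0 ≤ s x) {η ε : ℝ} (hε : ε ≤ 1 / 8)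
    (hεη : ε ≤ η / 8) (h₁ : ∀ᵐ x ∂volume.restrict J, |ε₁ x| ≤ ε)
    (h₂ : ∀ᵐ x ∂volume.restrict J, |ε₂ x| ≤ ε)
    (hD : ∀ᵐ x ∂volume.restrict J, -1 / 4 + η ≤ D x) (hg : 0 < g x₀) (hh : g x₀ / 2 < h x₀)
    {x : ℝ} (hx : x ∈ J) : 0 < g x := by
  have hE := hsys.snd.sub (hsys.fst.const_mul (1 / 2))
  refine pos_of_nonneg_deriv hleft hx₀ hsys.fst hE ?_ hg (by linarith) hx
  filter_upwards [hs, h₁, h₂, hD] with x hs h₁ h₂ hD hg hE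
  obtain ⟨h₁, h₁'⟩ := abs_le.1 h₁
  obtain ⟨h₂, h₂'⟩ := abs_le.1 h₂
  constructor
  · refine mul_nonneg hs ?_
    rw [show -ε₁ x * g x + (1 - ε₂ x) * h x = (-ε₁ x + (1 - ε₂ x) / 2) * g x +
      (1 - ε₂ x) * (h x - 1 / 2 * g x) by ring]
    exact add_nonneg (mul_nonneg (by linarith) hg) (mul_nonneg (by linarith) hE)
  · rw [show s x * (D x * g x + ε₁ x * h x + h x) -
      1 / 2 * (s x * (-ε₁ x * g x + (1 - ε₂ x) * h x)) =
      s x * ((D x + 1 / 4 + ε₁ x + ε₂ x / 4) * g x +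
        (1 / 2 + ε₁ x + ε₂ x / 2) * (h x - 1 / 2 * g x)) by ring]
    exact mul_nonneg hs
      (add_nonneg (mul_nonneg (by linarith) hg) (mul_nonneg (by linarith) hE))

/-! ### Sturm--Liouville solutions and behaviour at the endpoint -/

lemma intervalIntegrable_of_integrableOn_Ioo {a : ℝ} {b : EReal} {f : ℝ → ℝ}
    (h : ∀ c ∈ ivl a b, IntegrableOn f (Ioo a c)) :
    ∀ x ∈ ivlCO a b, ∀ y ∈ ivlCO a b, IntervalIntegrable f volume x y := by
  intro x hx y hy
  have hmax : ((max x y : ℝ) : EReal) < b := by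
    rcases max_choice x y with h | h <;> rw [h]
    exacts [hx.2, hy.2]
  obtain ⟨c, hc, hcb⟩ := exists_gt_lt_end hmax
  rw [intervalIntegrable_iff]
  refine (h c ⟨(hx.1.trans (le_max_left x y)).trans_lt hc, hcb⟩).mono_set fun t ht => ?_
  exact ⟨(le_min hx.1 hy.1).trans_lt ht.1, ht.2.trans_lt hc⟩

namespace SLExpr

variable {τ : SLExpr} {lam a : ℝ} {b : EReal} {u : ℝ → ℝ}

/-- A solution `u` and its quasi-derivative `w = p u'` solve a first-order linear system. -/
lemma IsSolution.exists_linear_system (hp : ∀ᵐ x ∂volume.restrict (ivl a b), 0 < τ.p x)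
    (hr : ∀ᵐ x ∂volume.restrict (ivl a b), 0 < τ.r x) (h : τ.IsSolution lam a b u) :
    ∃ w : ℝ → ℝ, LocACDeriv (ivl a b) u (fun x => 1 / τ.p x * w x) ∧
      LocACDeriv (ivl a b) w (fun x => (τ.q x - lam * τ.r x) * u x) ∧
      ∀ᵐ x ∂volume.restrict (ivl a b), w x = τ.p x * deriv u x := by
  obtain ⟨hu, w, hw, hwp, heq⟩ := h
  simp only [RCLike.ofReal_real_eq_id, id] at hwp heq
  refine ⟨w, (LocACDeriv.of_locAC hu).congr_deriv ?_, (LocACDeriv.of_locAC hw).congr_deriv ?_, hwp⟩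
  · filter_upwards [hp, hwp] with x hp hw
    rw [hw]
    field_simp
  · filter_upwards [hr, heq] with x hr h
    field_simp at h
    linarith

lemma isSolution_of_linear_system (hp : ∀ᵐ x ∂volume.restrict (ivl a b), 0 < τ.p x)
    (hr : ∀ᵐ x ∂volume.restrict (ivl a b), 0 < τ.r x) {w : ℝ → ℝ}
    (hu : LocACDeriv (ivl a b) u (fun x => 1 / τ.p x * w x))
    (hw : LocACDeriv (ivl a b) w (fun x => (τ.q x - lam * τ.r x) * u x)) :
    τ.IsSolution lam a b u := by
  refine ⟨hu.locAC, w, hw.locAC, ?_, ?_⟩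
  · filter_upwards [hp, hu.ae_hasDerivAt] with x hp hx
    simp only [RCLike.ofReal_real_eq_id, id, hx.deriv]
    field_simp
  · filter_upwards [hr, hw.ae_hasDerivAt] with x hr hx
    simp only [RCLike.ofReal_real_eq_id, id, hx.deriv]
    field_simp
    ring

end SLExpr

/-- A property that holds eventually near `b` up to null sets holds almost everywhere on some
interval `(x₁, b)`. -/
lemma exists_ae_of_eventually_nearEnd {b : EReal} {c : ℝ} (hc : (c : EReal) < b) {P : ℝ → Prop}
    (h : ∀ᶠ x in nearEnd b, P x) : ∃ x₁ ∈ ivl c b, ∀ᵐ x ∂volume.restrict (ivl x₁ b), P x := by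
  obtain ⟨s, hs, t, ht, hst⟩ := mem_inf_iff.1 h
  obtain ⟨U, hU, hUs⟩ := mem_comap.1 hs
  obtain ⟨l, hl, hlU⟩ := (mem_nhdsLT_iff_exists_Ioo_subset' hc).1 hU
  obtain ⟨x₁, h₁, h₂⟩ := EReal.lt_iff_exists_real_btwn.1 (max_lt hl hc)
  refine ⟨x₁, ⟨EReal.coe_lt_coe_iff.1 ((le_max_right _ _).trans_lt h₁), h₂⟩, ?_⟩
  rw [ae_restrict_iff' (measurableSet_ivl _ _)]
  filter_upwards [ht] with x hx hxI
  have hxs : x ∈ s := hUs (hlU ⟨((le_max_left _ _).trans_lt h₁).trans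
    (EReal.coe_lt_coe_iff.2 hxI.1), hxI.2⟩)
  exact hst.ge ⟨hxs, hx⟩

/-- If `∫_c^b f = ∞` for a nonnegative function `f`, the primitives `∫_c^x f` are unbounded. -/
lemma exists_lt_integral_of_lintegral_eq_top {c x₀ : ℝ} {b : EReal} {f : ℝ → ℝ}
    (hx₀ : x₀ ∈ ivl c b) (hf0 : ∀ᵐ x ∂volume.restrict (ivl c b), 0 ≤ f x)
    (hf : ∀ x ∈ ivl c b, IntervalIntegrable f volume c x)
    (htop : ∫⁻ t in ivl c b, ENNReal.ofReal (f t) = ⊤) (M : ℝ) :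
    ∃ x ∈ ivlCO x₀ b, M < ∫ t in c..x, f t := by
  by_contra! hM
  -- rational right endpoints keep the exhaustion of `(c, b)` countable
  let ι := {q : ℚ // (q : ℝ) ∈ ivl x₀ b}
  have hcover : ivl c b = ⋃ q : ι, Ioo c (q.1 : ℝ) := by
    ext x
    simp only [mem_iUnion]
    constructor
    · intro hx
      have : ((max x x₀ : ℝ) : EReal) < b := by
        rcases max_choice x x₀ with h | h <;> rw [h]
        exacts [hx.2, hx₀.2]
      obtain ⟨y, hy, hyb⟩ := exists_gt_lt_end this
      obtain ⟨q, hq, hqy⟩ := exists_rat_btwn hy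
      exact ⟨⟨q, (le_max_right _ _).trans_lt hq, (EReal.coe_lt_coe_iff.2 hqy).trans hyb⟩,
        hx.1, (le_max_left _ _).trans_lt hq⟩
    · rintro ⟨q, hq⟩
      exact ⟨hq.1, (EReal.coe_lt_coe_iff.2 hq.2).trans q.2.2⟩
  have hdir : Directed (· ⊆ ·) fun q : ι => Ioo c (q.1 : ℝ) :=
    Monotone.directed_le fun q r hqr => Ioo_subset_Ioo_right (by exact_mod_cast hqr)
  rw [hcover, setLIntegral_iUnion_of_directed _ hdir] at htop
  refine (lt_of_le_of_lt (iSup_le fun q => ?_) (ENNReal.ofReal_lt_top (r := M))).ne htop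
  have hq : (q.1 : ℝ) ∈ ivl c b := ⟨hx₀.1.trans q.2.1, q.2.2⟩
  have hsub : Ioo c (q.1 : ℝ) ⊆ ivl c b := hcover ▸ subset_iUnion (fun q : ι => Ioo c (q.1 : ℝ)) q
  have hint := (intervalIntegrable_iff_integrableOn_Ioo_of_le hq.1.le).1 (hf _ hq)
  rw [← ofReal_integral_eq_lintegral_ofReal hint (ae_restrict_of_ae_restrict_of_subset hsub hf0),
    ← integral_Ioc_eq_integral_Ioo, ← intervalIntegral.integral_of_le hq.1.le]
  exact ENNReal.ofReal_le_ofReal (hM _ ⟨q.2.1.le, q.2.2⟩)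

/-- Finitely many points below `b` all lie below some point that is still below `b`. -/
lemma exists_gt_of_finite {a x₁ : ℝ} {b : EReal} (hx₁ : x₁ ∈ ivl a b) {S : Set ℝ}
    (hS : S.Finite) (hSb : S ⊆ ivl a b) : ∃ x₀ ∈ ivl x₁ b, ∀ x ∈ S, x < x₀ := by
  obtain ⟨m, hm, hmax⟩ := Set.exists_max_image (insert x₁ S) id (hS.insert x₁) (insert_nonempty _ _)
  have hmb : (m : EReal) < b := by
    rcases hm with rfl | hm
    exacts [hx₁.2, (hSb hm).2]
  obtain ⟨x₀, h, hb⟩ := exists_gt_lt_end hmb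
  exact ⟨x₀, ⟨(hmax x₁ (mem_insert _ _)).trans_lt h, hb⟩,
    fun x hx => (hmax x (mem_insert_of_mem _ hx)).trans_lt h⟩

/-! ### The oscillation criterion -/

theorem theorem3p4 (a : ℝ) (b : EReal) (hab : (a : EReal) < b) (τ₀ τ₁ : SLExpr)
    (hτ₀ : τ₀.Admissible a b) (hτ₁ : τ₁.Admissible a b)
    (T₀ : τ₀.L2 a b →ₗ.[ℂ] τ₀.L2 a b) (hT₀ : τ₀.IsSelfAdjointRealization a b T₀)
    (lam : ℝ) (hlam : IsLeast {t : ℝ | (t : ℂ) ∈ opSpectrum T₀} lam)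
    (d : ℝ) (had : a ≤ d) (u₀ : ℝ → ℝ) (hu₀ : IsMinimalPositive τ₀ lam d b u₀)
    (c : ℝ) (hc : c ∈ ivl d b) (v₀ : ℝ → ℝ) (hv₀ : ∀ x ∈ ivl d b, v₀ x = dAlembert τ₀ c u₀ x)
    (hlim₁ : Tendsto
      (fun x => v₀ x * (τ₀.p x * deriv u₀ x) * ((τ₁.p x - τ₀.p x) / τ₁.p x)) (nearEnd b) (𝓝 0))
    (hlim₂ : Tendsto (fun x => (τ₁.p x - τ₀.p x) / τ₁.p x) (nearEnd b) (𝓝 0)) :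
    (limsup (fun x => (critDelta τ₀ τ₁ lam u₀ v₀ x : EReal)) (nearEnd b) <
        ((-1 / 4 : ℝ) : EReal) → τ₁.Oscillatory lam a b) ∧
    (((-1 / 4 : ℝ) : EReal) <
        liminf (fun x => (critDelta τ₀ τ₁ lam u₀ v₀ x : EReal)) (nearEnd b) →
      τ₁.Nonoscillatory lam a b) := by
  obtain ⟨hsol, hu0, hdiv⟩ := hu₀
  have hab' : ivl d b ⊆ ivl a b := fun x hx => ⟨had.trans_lt hx.1, hx.2⟩
  have hcd : ivl c b ⊆ ivl d b := fun x hx => ⟨hc.1.trans hx.1, hx.2⟩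
  have hac : a < c := had.trans_lt hc.1
  have := ordConnected_ivl a b
  have := ordConnected_ivl c b
  have := ordConnected_ivl d b
  have := ordConnected_ivlCO a b
  have hp₀ := ae_restrict_of_ae_restrict_of_subset hab' hτ₀.p_pos
  have hp₁ := ae_restrict_of_ae_restrict_of_subset hab' hτ₁.p_pos
  obtain ⟨w, hu, hw, hwp⟩ := hsol.exists_linear_system hp₀
    (ae_restrict_of_ae_restrict_of_subset hab' hτ₀.r_pos)
  -- `φ = v₀ / u₀` tends to infinity at `b`
  set φ : ℝ → ℝ := fun x => ∫ t in c..x, 1 / (τ₀.p t * u₀ t ^ 2) with hφdef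
  have hint : ∀ x ∈ ivl d b, ∀ y ∈ ivl d b,
      IntervalIntegrable (fun t => 1 / (τ₀.p t * u₀ t ^ 2)) volume x y := by
    intro x hx y hy
    have hcont : ContinuousOn (fun t => (u₀ t ^ 2)⁻¹) (ivl d b) :=
      (hu.continuousOn.pow 2).inv₀ fun t ht => (pow_pos (hu0 t ht) 2).ne'
    have := (intervalIntegrable_of_integrableOn_Ioo hτ₀.p_inv_int x (ivl_subset_ivlCO had hx)
      y (ivl_subset_ivlCO had hy)).mul_continuousOn
      (hcont.mono ((ordConnected_ivl d b).uIcc_subset hx hy))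
    simpa only [one_div, mul_inv] using this
  have hφ : LocACDeriv (ivl d b) φ _ := LocACDeriv.primitive hc hint
  have hφ'pos : ∀ᵐ x ∂volume.restrict (ivl d b), 0 < 1 / (τ₀.p x * u₀ x ^ 2) := by
    filter_upwards [hp₀, ae_restrict_mem (measurableSet_ivl d b)] with x hx hxI
    have := hu0 x hxI
    positivity
  have hφpos : ∀ x ∈ ivl c b, 0 < φ x := fun x hx => by
    have := hφ.lt_of_pos hc (hcd hx) hx.1 <| ae_restrict_of_ae_restrict_of_subset
      (t := ivl d b) (fun t ht => ⟨hc.1.trans ht.1, (EReal.coe_lt_coe_iff.2 ht.2).trans hx.2⟩)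
      hφ'pos
    simpa [hφdef] using this
  have hv : ∀ x ∈ ivl d b, v₀ x = u₀ x * φ x := hv₀
  set s : ℝ → ℝ := fun x => 1 / (τ₀.p x * u₀ x ^ 2 * φ x) with hsdef
  have hs0 : ∀ᵐ x ∂volume.restrict (ivl c b), 0 ≤ s x := by
    filter_upwards [ae_restrict_of_ae_restrict_of_subset hcd hp₀,
      ae_restrict_mem (measurableSet_ivl c b)] with x hx hxI
    have := hφpos x hxI
    positivity
  have hL : LocACDeriv (ivl c b) (fun x => Real.log (φ x)) s := by
    refine ((hφ.mono hcd).log fun x hx => (hφpos x hx).ne').congr_deriv ?_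
    refine Eventually.of_forall fun x => ?_
    rw [hsdef]
    simp only [one_div, mul_inv]
    ring
  set ε₁ : ℝ → ℝ := fun x => v₀ x * (τ₀.p x * deriv u₀ x) * ((τ₁.p x - τ₀.p x) / τ₁.p x)
  set ε₂ : ℝ → ℝ := fun x => (τ₁.p x - τ₀.p x) / τ₁.p x
  set D : ℝ → ℝ := critDelta τ₀ τ₁ lam u₀ v₀ with hDdef
  have hsys : ∀ x₀ ∈ ivl c b, ∀ y z : ℝ → ℝ,
      LocACDeriv (ivlCO x₀ b) y (fun x => 1 / τ₁.p x * z x) →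
      LocACDeriv (ivlCO x₀ b) z (fun x => (τ₁.q x - lam * τ₁.r x) * y x) →
      RenormalizedSystem (ivlCO x₀ b) s ε₁ ε₂ D (fun x => y x / u₀ x)
        (fun x => φ x * (u₀ x * z x - w x * y x)) := by
    intro x₀ hx₀ y z hy hz
    have hJc : ivlCO x₀ b ⊆ ivl c b := ivlCO_subset_ivl hx₀.1
    have hJ := hJc.trans hcd
    have := ordConnected_ivlCO x₀ b
    have hwp' := ae_restrict_of_ae_restrict_of_subset hJ hwp
    have hmem := ae_restrict_mem (μ := volume) (measurableSet_ivlCO x₀ b)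
    refine renormalizedSystem_of_solutions (ae_restrict_of_ae_restrict_of_subset hJ hp₀)
      (ae_restrict_of_ae_restrict_of_subset hJ hp₁) (fun x hx => hu0 x (hJ hx))
      (fun x hx => hφpos x (hJc hx)) (hu.mono hJ) (hw.mono hJ) (hφ.mono hJ) hy hz
      (Eventually.of_forall fun _ => rfl) ?_ (Eventually.of_forall fun _ => rfl) ?_
    · filter_upwards [hwp', hmem] with x hx hxJ
      simp only [ε₁, hv x (hJ hxJ), ← hx]
    · filter_upwards [hwp', hmem] with x hx hxJ
      rw [hDdef, critDelta, hv x (hJ hxJ), ← hx]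
      ring
  have hsmall : ∀ ε : ℝ, 0 < ε → ∀ᶠ x in nearEnd b, |ε₁ x| ≤ ε ∧ |ε₂ x| ≤ ε := by
    intro ε hε
    filter_upwards [hlim₁ (Metric.closedBall_mem_nhds 0 hε),
      hlim₂ (Metric.closedBall_mem_nhds 0 hε)] with x h₁ h₂
    exact ⟨by simpa using h₁, by simpa using h₂⟩
  constructor
  · rintro hlimsup ⟨y, hy, -, hfin⟩
    obtain ⟨r, hr, hr'⟩ := EReal.lt_iff_exists_real_btwn.1 hlimsup
    have hη : 0 < -1 / 4 - r := by linarith [EReal.coe_lt_coe_iff.1 hr']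
    set η := -1 / 4 - r with hηdef
    set ε := min (1 / 8) (η / 8)
    have hε : 0 < ε := lt_min (by norm_num) (by linarith)
    obtain ⟨x₁, hx₁, hev⟩ := exists_ae_of_eventually_nearEnd hc.2
      ((eventually_lt_of_limsup_lt hr).and (hsmall ε hε))
    obtain ⟨z, hyz, hz, -⟩ := hy.exists_linear_system hτ₁.p_pos hτ₁.r_pos
    obtain ⟨x₀, hx₀, hzero⟩ := exists_gt_of_finite ⟨hac.trans hx₁.1, hx₁.2⟩ hfin (sep_subset _ _)
    have hx₀c : x₀ ∈ ivl c b := ⟨hx₁.1.trans hx₀.1, hx₀.2⟩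
    have hJ₁ : ivlCO x₀ b ⊆ ivl x₁ b := ivlCO_subset_ivl hx₀.1
    have hJc : ivlCO x₀ b ⊆ ivl c b := ivlCO_subset_ivl hx₀c.1
    have hJa : ivlCO x₀ b ⊆ ivl a b := (hJc.trans hcd).trans hab'
    have := ordConnected_ivlCO x₀ b
    have hev' := ae_restrict_of_ae_restrict_of_subset hJ₁ hev
    have hx₀J : x₀ ∈ ivlCO x₀ b := ⟨le_rfl, hx₀.2⟩
    obtain ⟨M, hM⟩ := (hsys x₀ hx₀c y z (hyz.mono hJa) (hz.mono hJa)).bddAbove_of_ne_zero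
      hx₀J (fun x hx => hx.1) (hL.mono hJc)
      (ae_restrict_of_ae_restrict_of_subset hJc hs0) hη (min_le_left _ _) (min_le_right _ _)
      (hev'.mono fun x hx => hx.2.1) (hev'.mono fun x hx => hx.2.2)
      (hev'.mono fun x hx => by linarith [EReal.coe_lt_coe_iff.1 hx.1])
      (fun x hx => div_ne_zero (fun h => (hzero x ⟨hJa hx, h⟩).not_ge hx.1)
        (hu0 x (hcd (hJc hx))).ne')
    obtain ⟨x, hx, hMx⟩ := exists_lt_integral_of_lintegral_eq_top hx₀c
      ((ae_restrict_of_ae_restrict_of_subset hcd hφ'pos).mono fun _ h => h.le)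
      (fun x hx => hint c hc x (hcd hx)) (hdiv c hc) (Real.exp M)
    exact hMx.not_ge ((Real.log_le_iff_le_exp (hφpos x (hJc hx))).1 (hM x hx))
  · intro hliminf
    obtain ⟨r, hr, hr'⟩ := EReal.lt_iff_exists_real_btwn.1 hliminf
    have hη : 0 < r + 1 / 4 := by linarith [EReal.coe_lt_coe_iff.1 hr]
    set η := r + 1 / 4 with hηdef
    set ε := min (1 / 8) (η / 8)
    have hε : 0 < ε := lt_min (by norm_num) (by linarith)
    obtain ⟨x₁, hx₁, hev⟩ := exists_ae_of_eventually_nearEnd hc.2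
      ((eventually_lt_of_lt_liminf hr').and (hsmall ε hε))
    obtain ⟨x₀, hx₀, hx₀b⟩ := exists_gt_lt_end hx₁.2
    have hx₀c : x₀ ∈ ivl c b := ⟨hx₁.1.trans hx₀, hx₀b⟩
    have hx₀d := hcd hx₀c
    have hx₀a : x₀ ∈ ivlCO a b := ivl_subset_ivlCO had hx₀d
    have hA := intervalIntegrable_of_integrableOn_Ioo hτ₁.p_inv_int
    have hB : ∀ x ∈ ivlCO a b, ∀ y ∈ ivlCO a b,
        IntervalIntegrable (fun t => τ₁.q t - lam * τ₁.r t) volume x y :=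
      intervalIntegrable_of_integrableOn_Ioo fun e he =>
        (hτ₁.q_int e he).sub ((hτ₁.r_int e he).const_mul lam)
    -- initial values for which `g = 1` and `h = 1` at `x₀`
    obtain ⟨y, z, hy, hz, hy₀, hz₀⟩ := exists_solution_linear_system hx₀a hA hB (u₀ x₀)
      ((1 / φ x₀ + w x₀ * u₀ x₀) / u₀ x₀)
    have hu₀x₀ := hu0 x₀ hx₀d
    have hφx₀ := hφpos x₀ hx₀c
    have hJ₁ : ivlCO x₀ b ⊆ ivl x₁ b := ivlCO_subset_ivl hx₀
    have hJc : ivlCO x₀ b ⊆ ivl c b := ivlCO_subset_ivl hx₀c.1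
    have hJa : ivlCO x₀ b ⊆ ivlCO a b := fun x hx => ⟨hx₀a.1.trans hx.1, hx.2⟩
    have := ordConnected_ivlCO x₀ b
    have hev' := ae_restrict_of_ae_restrict_of_subset hJ₁ hev
    have hx₀J : x₀ ∈ ivlCO x₀ b := ⟨le_rfl, hx₀b⟩
    have hpos : ∀ x ∈ ivlCO x₀ b, 0 < y x := by
      intro x hx
      have h := (hsys x₀ hx₀c y z (hy.mono hJa) (hz.mono hJa)).pos
        hx₀J (fun x hx => hx.1)
        (ae_restrict_of_ae_restrict_of_subset hJc hs0) (min_le_left _ _) (min_le_right _ _)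
        (hev'.mono fun x hx => hx.2.1) (hev'.mono fun x hx => hx.2.2)
        (hev'.mono fun x hx => by linarith [EReal.coe_lt_coe_iff.1 hx.1])
        (by rw [hy₀, div_self hu₀x₀.ne']; exact one_pos)
        (by
          rw [hy₀, hz₀, div_self hu₀x₀.ne', mul_div_cancel₀ _ hu₀x₀.ne', add_sub_cancel_right,
            mul_one_div_cancel hφx₀.ne']
          norm_num) hx
      exact (div_pos_iff_of_pos_right (hu0 x (hcd (hJc hx)))).1 h
    have hsub : ivl a b ⊆ ivlCO a b := ivl_subset_ivlCO le_rfl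
    refine ⟨y, SLExpr.isSolution_of_linear_system hτ₁.p_pos hτ₁.r_pos (hy.mono hsub)
      (hz.mono hsub), ⟨x₀, hab' hx₀d, (hpos x₀ hx₀J).ne'⟩, ?_⟩
    have hApos : ∀ᵐ x ∂volume.restrict (ivlCO a b), 0 < 1 / τ₁.p x := by
      refine ae_restrict_of_ae_restrict_inter_Ioo fun x x' hx hx' _ => ?_
      filter_upwards [ae_restrict_of_ae_restrict_of_subset (s := ivlCO a b ∩ Ioo x x')
        (t := ivl a b) (fun t ht => ⟨hx.1.trans_lt ht.2.1, ht.1.2⟩) hτ₁.p_pos] with t ht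
      positivity
    have hN : ∀ x ∈ ivlCO a b, 0 < y x ^ 2 + z x ^ 2 := fun x hx =>
      sq_add_sq_pos_of_linear_system hx₀a hA hB hy hz (by rw [hy₀]; positivity) hx
    refine (finite_zeros_of_linear_system hApos hy hz.continuousOn hN
      ((ordConnected_ivlCO a b).out ⟨le_rfl, hab⟩ hx₀a)).subset fun x hx => ⟨⟨hx.1.1.le, ?_⟩, hx.2⟩
    by_contra hlt
    exact (hpos x ⟨(not_le.1 hlt).le, hx.1.2⟩).ne' hx.2
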